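/- A hyperbolic lattice is a free abelian group $L$ of finite rank $r$ with a nondegenerate symmetric bilinear form $(\cdot,\cdot)\colon L\times L\to\mathbb{Z}$ whose extension to $L_{\mathbb{R}}=L\otimes_{\mathbb{Z}}\mathbb{R}$ has signature $(1,r-1)$. Its positive cone $\mathcal{C}(L_{\mathbb{R}})$ is a chosen one of the two connected components of $\{x\in L_{\mathbb{R}} : (x,x)>0\}$, and $\overline{\mathcal{C}}(L_{\mathbb{R}})$ is its closure in $L_{\mathbb{R}}$. Let $\mathrm{O}(L)'$ be the group of automorphisms $g$ of $L$ with $(gx,gy)=(x,y)$ for all $x,y\in L$ whose $\mathbb{R}$-linear extension (again denoted $g$) maps $\mathcal{C}(L_{\mathbb{R}})$ onto itself. The entropy of $g$ is $h(g)=\log\rho(g)$, where $\rho(g)$ is the maximum of $|\mu|$ over the eigenvalues $\mu\in\mathbb{C}$ of $g$ on $L\otimes_{\mathbb{Z}}\mathbb{C}$. Proposition. Let $L$ be a hyperbolic lattice and let $g_1,g_2\in\mathrm{O}(L)'$, both of positive entropy. Suppose that there is a nonzero $v\in\overline{\mathcal{C}}(L_{\mathbb{R}})$ such that $g_1(v)=\lambda_1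 v$ and $g_2(v)=\lambda_2 v$ for some real numbers $\lambda_1,\lambda_2>0$. Then $g_1^{t_1}=g_2^{t_2}$ for some $t_1,t_2\in\mathbb{Z}\setminus\{0\}$. -/

import Mathlib

open scoped TensorProduct

noncomputable section

namespace HyperbolicLattice

variable {L : Type*} [AddCommGroup L]

/-- The real space `L_ℝ = ℝ ⊗ L` with its usual
topology (for `L` of finite rank the module topology is the Euclidean topology). -/
instance realTopology : TopologicalSpace (ℝ ⊗[ℤ] L) := moduleTopology ℝ (ℝ ⊗[ℤ] L)

instance realIsModuleTopology : IsModuleTopology ℝ (ℝ ⊗[ℤ] L) := ⟨rfl⟩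

/-- The real quadratic form `x ↦ (x, x)` on `L_ℝ`, where `(·, ·)` is extended `ℝ`-bilinearly. -/
def realForm (B : LinearMap.BilinForm ℤ L) : QuadraticForm ℝ (ℝ ⊗[ℤ] L) :=
  (B.baseChange ℝ).toQuadraticMap

/-- The free abelian group `L` of finite rank `r` is a hyperbolic lattice for `B`: `B` is symmetric,
nondegenerate, and its real extension has signature `(1, r - 1)`. -/
structure IsHyperbolic (B : LinearMap.BilinForm ℤ L) : Prop where
  symm : B.IsSymm
  nondegenerate : B.Nondegenerate
  sigPos_eq : sigPos (realForm B) = 1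
  sigNeg_eq : sigNeg (realForm B) + 1 = Module.finrank ℤ L

/-- `C` is one of the connected components of `{x ∈ L_ℝ : (x, x) > 0}`. -/
def IsPositiveCone (B : LinearMap.BilinForm ℤ L) (C : Set (ℝ ⊗[ℤ] L)) : Prop :=
  ∃ x, 0 < realForm B x ∧ C = connectedComponentIn {y | 0 < realForm B y} x

/-- The group `O(L)` of isometries of `L`. -/
def isometryGroup (B : LinearMap.BilinForm ℤ L) : Subgroup (L ≃ₗ[ℤ] L) where
  carrier := {g | ∀ x y, B (g x) (g y) = B x y}
  one_mem' := fun _ _ => rfl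
  mul_mem' := fun {g h} hg hh x y => (hg (h x) (h y)).trans (hh x y)
  inv_mem' := fun {g} hg x y => by
    have h := hg (g.symm x) (g.symm y)
    rw [g.apply_symm_apply, g.apply_symm_apply] at h
    exact h.symm

/-- The `ℝ`-linear extension of an automorphism of `L` to `L_ℝ`. -/
def realExt (g : L ≃ₗ[ℤ] L) : (ℝ ⊗[ℤ] L) →ₗ[ℝ] (ℝ ⊗[ℤ] L) :=
  (g : L →ₗ[ℤ] L).baseChange ℝ

theorem realExt_one : realExt (1 : L ≃ₗ[ℤ] L) = LinearMap.id := by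
  ext; rfl

theorem realExt_mul (g h : L ≃ₗ[ℤ] L) : realExt (g * h) = realExt g ∘ₗ realExt h := by
  ext; rfl

/-- The subgroup `O(L)'` of the isometries of `L` that preserve the positive cone `C`. -/
def coneIsometryGroup (B : LinearMap.BilinForm ℤ L) (C : Set (ℝ ⊗[ℤ] L)) :
    Subgroup (L ≃ₗ[ℤ] L) where
  carrier := {g | g ∈ isometryGroup B ∧ realExt g '' C = C}
  one_mem' := ⟨one_mem _, by rw [realExt_one]; simp⟩
  mul_mem' := fun {g h} hg hh => ⟨mul_mem hg.1 hh.1, by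
    rw [realExt_mul, LinearMap.coe_comp, Set.image_comp, hh.2, hg.2]⟩
  inv_mem' := fun {g} hg => ⟨inv_mem hg.1, by
    conv_lhs => rw [← hg.2]
    rw [← Set.image_comp, ← LinearMap.coe_comp, ← realExt_mul, inv_mul_cancel, realExt_one]
    simp⟩

/-- The spectral radius of an endomorphism of `L`: the largest modulus of a complex eigenvalue
of its `ℂ`-linear extension to `L_ℂ = ℂ ⊗ L`. -/
def specRadius (φ : L →ₗ[ℤ] L) : ℝ :=
  sSup {r : ℝ | ∃ μ : ℂ, Module.End.HasEigenvalue (φ.baseChange ℂ) μ ∧ r = ‖μ‖}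

/-- The entropy of an endomorphism of `L`: the logarithm of its spectral radius. -/
def entropy (φ : L →ₗ[ℤ] L) : ℝ := Real.log (specRadius φ)

end HyperbolicLattice

end

/-! If `c` is the eigenvalue of `g` at `v`, positive entropy forces `c ≠ 1`: were `v` fixed, a
complex eigenvector off the unit circle would have real and imaginary parts in the orthogonal
complement of `v`, with form values summing to zero, hence both proportional to `v`, which is
absurd. So `v` is isotropic, and `g₁` has a dual isotropic eigenvector `u` with eigenvalue `c₁⁻¹`.

The rest is discreteness (`finite_isometries_of_bounded`) at `p = u + v`, used twice. The conjugates
of `g₂` by powers of `g₁` move `p` boundedly, so two coincide, a power of `g₁` commutes with `g₂`,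
and `g₂` also preserves the line of `u`. Then products `g₁ ^ e * g₂ ^ b` with `c₁ ^ e * c₂ ^ b` kept
in a compact interval move `p` boundedly, and two of them coincide. -/

namespace HyperbolicLattice

/-! ### Lorentzian linear algebra -/

section Lorentzian

variable {V : Type*} [AddCommGroup V] [Module ℝ V]

/-- A symmetric real bilinear form that takes a positive value and is negative definite on the
orthogonal complement of every positive vector. -/
structure IsLorentzian (B : LinearMap.BilinForm ℝ V) : Prop where
  comm : ∀ x y, B x y = B y x
  exists_pos : ∃ p, 0 < B p p
  neg : ∀ p x, 0 < B p p → B x p = 0 → x ≠ 0 → B x x < 0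

/-- Otherwise `p` and `y` would span a positive definite plane. -/
theorem not_pos_of_sigPos_eq_one [FiniteDimensional ℝ V] {B : LinearMap.BilinForm ℝ V}
    (hcomm : ∀ x y, B x y = B y x) (hs : sigPos B.toQuadraticMap = 1) {p y : V}
    (hp : 0 < B p p) (hyp : B y p = 0) : ¬ 0 < B y y := by
  intro hy
  have hpy : B p y = 0 := by rw [hcomm, hyp]
  have key : ∀ a b : ℝ, B (a • p + b • y) (a • p + b • y) = a ^ 2 * B p p + b ^ 2 * B y y := by
    intro a b
    simp [hyp, hpy]
    ring
  have hli : LinearIndependent ℝ ![p, y] := by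
    rw [LinearIndependent.pair_iff]
    intro a b hab
    have h := key a b
    rw [hab] at h
    simp only [map_zero] at h
    have ha : 0 ≤ a ^ 2 * B p p := by positivity
    have hb : 0 ≤ b ^ 2 * B y y := by positivity
    have ha' : a ^ 2 * B p p = 0 := by linarith
    have hb' : b ^ 2 * B y y = 0 := by linarith
    simpa [hp.ne', hy.ne'] using And.intro ha' hb'
  have hrank := finrank_span_eq_card hli
  have hpos : (B.toQuadraticMap.restrict (Submodule.span ℝ (Set.range ![p, y]))).PosDef := by
    rintro ⟨x, hx⟩ hx0
    simp only [Matrix.range_cons, Matrix.range_empty, Set.union_empty, Set.singleton_union] at hx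
    obtain ⟨a, b, rfl⟩ := Submodule.mem_span_pair.1 hx
    change 0 < B (a • p + b • y) (a • p + b • y)
    rw [key]
    by_cases ha : a = 0
    · have hb : b ≠ 0 := by
        rintro rfl
        exact hx0 (by simp [ha])
      have : 0 < b ^ 2 * B y y := by positivity
      nlinarith [mul_nonneg (sq_nonneg a) hp.le]
    · have : 0 < a ^ 2 * B p p := by positivity
      nlinarith [mul_nonneg (sq_nonneg b) hy.le]
  have h := le_sigPos_of_posDef _ hpos
  rw [hrank, hs] at h
  simp at h

theorem isLorentzian_of_sigPos_eq_one [FiniteDimensional ℝ V] {B : LinearMap.BilinForm ℝ V}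
    (hcomm : ∀ x y, B x y = B y x) (hs : sigPos B.toQuadraticMap = 1)
    (hnd : ∀ x, x ≠ 0 → ∃ y, B x y ≠ 0) : IsLorentzian B where
  comm := hcomm
  exists_pos := by
    obtain ⟨W, hW, hpos⟩ := exists_finrank_eq_sigPos_and_posDef B.toQuadraticMap
    rw [hs] at hW
    have : Nontrivial W := Module.nontrivial_of_finrank_pos (R := ℝ) (by omega)
    obtain ⟨w, hw⟩ := exists_ne (0 : W)
    exact ⟨w, hpos w hw⟩
  neg := by
    intro p x hp hxp hx
    by_contra! hxx
    have hxx0 : B x x = 0 := le_antisymm (not_lt.1 (not_pos_of_sigPos_eq_one hcomm hs hp hxp)) hxx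
    obtain ⟨z, hz⟩ := hnd x hx
    set y := z - (B z p / B p p) • p with hy
    have hyp : B y p = 0 := by
      simp [hy, hp.ne']
    have hxy : B x y = B x z := by
      simp [hy, hxp]
    -- An isotropic `x` orthogonal to `p` is excluded by making `t • x + y` a positive vector
    -- orthogonal to `p`; this `t` gives it norm exactly 1.
    set t := (1 - B y y) / (2 * B x z)
    refine not_pos_of_sigPos_eq_one hcomm hs (p := p) (y := t • x + y) hp
      (by simp [hxp, hyp]) ?_
    have : B (t • x + y) (t • x + y) = 2 * t * B x z + B y y := by
      simp [hxx0, hcomm y x, hxy]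
      ring
    rw [this]
    have h1 : 2 * t * B x z = 1 - B y y := by
      simp only [t]
      field_simp
    rw [h1]
    norm_num

variable {B : LinearMap.BilinForm ℝ V}

/-- For isotropic `v`, subtracting a multiple of `v` moves `x` into the complement of a positive `p`
without changing `B x x`. -/
theorem IsLorentzian.nonpos_of_orthogonal (h : IsLorentzian B) {v x : V} (hv : v ≠ 0)
    (hvv : 0 ≤ B v v) (hx : B x v = 0) : B x x ≤ 0 ∧ (B x x = 0 → ∃ a : ℝ, x = a • v) := by
  rcases hvv.lt_or_eq with hvv | hvv
  · by_cases hx0 : x = 0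
    · subst hx0
      exact ⟨by simp, fun _ => ⟨0, by simp⟩⟩
    · have := h.neg v x hvv hx hx0
      exact ⟨this.le, fun h0 => absurd h0 this.ne⟩
  · obtain ⟨p, hp⟩ := h.exists_pos
    have hvp : B v p ≠ 0 := fun h0 => (h.neg p v hp h0 hv).ne hvv.symm
    set y := x - (B x p / B v p) • v with hy
    have hyp : B y p = 0 := by simp [hy, hvp]
    have hyy : B y y = B x x := by
      simp [hy, hx, h.comm v x, ← hvv]
    rw [← hyy]
    by_cases hy0 : y = 0
    · rw [hy0]
      exact ⟨by simp, fun _ => ⟨_, sub_eq_zero.1 hy0⟩⟩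
    · have := h.neg p y hp hyp hy0
      exact ⟨this.le, fun h0 => absurd h0 this.ne⟩

theorem IsLorentzian.exists_ne_zero (h : IsLorentzian B) {x : V} (hx : x ≠ 0) :
    ∃ y, B x y ≠ 0 := by
  by_contra! h0
  obtain ⟨p, hp⟩ := h.exists_pos
  exact (h.neg p x hp (h0 p) hx).ne (h0 x)

/-- Every linear functional is bounded with respect to the positive definite form obtained from a
Lorentzian form by changing its sign on the orthogonal complement of a positive vector `p`. -/
theorem IsLorentzian.exists_functional_bound [FiniteDimensional ℝ V] (h : IsLorentzian B) {p : V}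
    (hp : 0 < B p p) (φ : V →ₗ[ℝ] ℝ) :
    ∃ K : ℝ, 0 ≤ K ∧ ∀ x, φ x ^ 2 ≤ K * (2 * B x p ^ 2 / B p p - B x x) := by
  let N : LinearMap.BilinForm ℝ V :=
    (2 / B p p) • LinearMap.BilinForm.linMulLin (B p) (B p) - B
  have hN : ∀ x y, N x y = 2 * B p x * B p y / B p p - B x y := by
    intro x y
    simp [N]
    ring
  have hpos : ∀ x, x ≠ 0 → 0 < N x x := by
    intro x hx
    set a := B x p / B p p with ha
    set y := x - a • p with hy
    have hyp : B y p = 0 := by simp [hy, ha, hp.ne']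
    have hxy : x = a • p + y := by simp [hy]
    have hxx : N x x = a ^ 2 * B p p - B y y := by
      rw [hN, hxy]
      simp [hyp, h.comm p y]
      field_simp
      ring
    rw [hxx]
    by_cases hy0 : y = 0
    · have ha0 : a ≠ 0 := by
        intro ha0
        rw [hy0, ha0] at hxy
        exact hx (by simpa using hxy)
      rw [hy0]
      simp only [map_zero, sub_zero]
      positivity
    · have := h.neg p y hp hyp hy0
      have : 0 ≤ a ^ 2 * B p p := by positivity
      linarith
  have hnn : ∀ x, 0 ≤ N x x := fun x => by
    by_cases hx : x = 0
    · simp [hx]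
    · exact (hpos x hx).le
  have hsymm : LinearMap.IsSymm N := ⟨fun x y => by
    simp only [hN, h.comm x y, RingHom.id_apply]
    ring⟩
  have hinj : Function.Injective N := by
    rw [← LinearMap.ker_eq_bot, LinearMap.ker_eq_bot']
    intro x hx
    by_contra hx0
    have := hpos x hx0
    rw [hx] at this
    simp at this
  have hsurj : Function.Surjective N :=
    (LinearMap.injective_iff_surjective_of_finrank_eq_finrank
      (Subspace.dual_finrank_eq (K := ℝ) (V := V)).symm).1 hinj
  -- `d` represents the functional for `N`; Cauchy–Schwarz gives the constant `N d d`.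
  obtain ⟨d, rfl⟩ := hsurj φ
  refine ⟨N d d, hnn d, fun x => ?_⟩
  have := LinearMap.BilinForm.apply_sq_le_of_symm N hnn hsymm d x
  rw [hN x x, h.comm p x] at this
  calc N d x ^ 2 ≤ _ := this
    _ = _ := by ring

end Lorentzian

/-! ### Isometries and discreteness -/

section Isometries

variable {L : Type*} [AddCommGroup L]

theorem realExt_mul_apply (g h : L ≃ₗ[ℤ] L) (x : ℝ ⊗[ℤ] L) :
    realExt (g * h) x = realExt g (realExt h x) := by
  rw [realExt_mul, LinearMap.comp_apply]

theorem realExt_apply_inv (g : L ≃ₗ[ℤ] L) (x : ℝ ⊗[ℤ] L) : realExt g (realExt g⁻¹ x) = x := by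
  rw [← realExt_mul_apply, mul_inv_cancel, realExt_one, LinearMap.id_apply]

theorem realExt_inv_apply (g : L ≃ₗ[ℤ] L) (x : ℝ ⊗[ℤ] L) : realExt g⁻¹ (realExt g x) = x := by
  rw [← realExt_mul_apply, inv_mul_cancel, realExt_one, LinearMap.id_apply]

theorem realExt_inv_eigenvector (g : L ≃ₗ[ℤ] L) {v : ℝ ⊗[ℤ] L} {c : ℝ} (hc : c ≠ 0)
    (h : realExt g v = c • v) : realExt g⁻¹ v = c⁻¹ • v := by
  have h1 := realExt_inv_apply g v
  rw [h, map_smul] at h1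
  rw [← h1, smul_smul, inv_mul_cancel₀ hc, one_smul, h1]

theorem realExt_zpow_apply (g : L ≃ₗ[ℤ] L) {v : ℝ ⊗[ℤ] L} {c : ℝ} (hc : c ≠ 0)
    (h : realExt g v = c • v) (n : ℤ) : realExt (g ^ n) v = c ^ n • v := by
  induction n with
  | zero => simp [realExt_one]
  | succ n ih =>
    rw [zpow_add_one, realExt_mul_apply, h, map_smul, ih, smul_smul,
      zpow_add_one₀ hc, mul_comm]
  | pred n ih =>
    rw [zpow_sub_one, realExt_mul_apply,
      realExt_inv_eigenvector g hc h, map_smul, ih, smul_smul,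
      zpow_sub_one₀ hc, mul_comm]

theorem baseChange_realExt {B : LinearMap.BilinForm ℤ L} {g : L ≃ₗ[ℤ] L}
    (hg : g ∈ isometryGroup B) (x y : ℝ ⊗[ℤ] L) :
    B.baseChange ℝ (realExt g x) (realExt g y) = B.baseChange ℝ x y := by
  have hg' : ∀ a b, B (g a) (g b) = B a b := hg
  induction x with
  | zero => simp
  | add x x' hx hx' => simp only [map_add, LinearMap.add_apply, hx, hx']
  | tmul a l =>
    induction y with
    | zero => simp
    | add y y' hy hy' => simp only [map_add, hy, hy']
    | tmul b m => simp [realExt, hg']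

theorem baseChange_realExt_left {B : LinearMap.BilinForm ℤ L} {g : L ≃ₗ[ℤ] L}
    (hg : g ∈ isometryGroup B) (x y : ℝ ⊗[ℤ] L) :
    B.baseChange ℝ (realExt g x) y = B.baseChange ℝ x (realExt g⁻¹ y) := by
  rw [← baseChange_realExt hg x, realExt_apply_inv]

variable [Module.Free ℤ L] [Module.Finite ℤ L] {B : LinearMap.BilinForm ℤ L}

theorem IsHyperbolic.isLorentzian (hB : IsHyperbolic B) : IsLorentzian (B.baseChange ℝ) := by
  have hcomm : ∀ x y, B.baseChange ℝ x y = B.baseChange ℝ y x := by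
    intro x y
    induction x with
    | zero => simp
    | add x x' hx hx' => simp only [map_add, LinearMap.add_apply, hx, hx']
    | tmul a l =>
      induction y with
      | zero => simp
      | add y y' hy hy' => simp only [map_add, LinearMap.add_apply, hy, hy']
      | tmul b m => simp [hB.symm.eq l m, mul_comm a b]
  refine isLorentzian_of_sigPos_eq_one hcomm hB.sigPos_eq fun x hx => ?_
  by_contra! h0
  -- The signature already exhausts the rank, so the radical vanishes.
  have hrad := QuadraticForm.sigPos_add_sigNeg_add_radical (Q := realForm B)
  rw [hB.sigPos_eq, Module.finrank_baseChange, ← hB.sigNeg_eq] at hrad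
  have hbot : (realForm B).radical = ⊥ := Submodule.finrank_eq_zero.1 (by omega)
  refine hx ((Submodule.mem_bot ℝ).1 (hbot ▸ QuadraticMap.mem_radical_iff'.2 ⟨h0 x, fun n => ?_⟩))
  simp [realForm, h0, hcomm n x]

/-- The isometries that move a positive vector by a bounded amount form a finite set. -/
theorem finite_isometries_of_bounded (hB : IsLorentzian (B.baseChange ℝ)) {p : ℝ ⊗[ℤ] L}
    (hp : 0 < B.baseChange ℝ p p) (M : ℝ) :
    {g | g ∈ isometryGroup B ∧ |B.baseChange ℝ (realExt g p) p| ≤ M}.Finite := by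
  classical
  let b := Module.Free.chooseBasis ℤ L
  set F := B.baseChange ℝ with hF
  set ι := Module.Free.ChooseBasisIndex ℤ L
  choose K₁ hK₁ hb₁ using fun i : ι => hB.exists_functional_bound hp ((b.baseChange ℝ).coord i)
  choose K₂ hK₂ hb₂ using fun i : ι => hB.exists_functional_bound hp (F (1 ⊗ₜ b i))
  -- Bound for the squared `j`-th coordinate of `g (b i)`: first bound its pairing with `p`, which
  -- is that of `b i` with `g⁻¹ p`, then use that `g` preserves the norm of `b i`.
  let R : ι → ι → ℝ := fun i j => K₁ j *
    (2 * (K₂ i * (2 * M ^ 2 / F p p - F p p)) / F p p - F (1 ⊗ₜ b i) (1 ⊗ₜ b i))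
  have hfin : {f : ι → ι → ℤ |
      ∀ i, f i ∈ {r : ι → ℤ | ∀ j, r j ∈ Set.Icc (-⌈R i j⌉) ⌈R i j⌉}}.Finite :=
    Set.Finite.pi' fun i => Set.Finite.pi' fun j => Set.finite_Icc _ _
  refine Set.Finite.of_injOn (f := fun g i j => b.repr (g (b i)) j) ?_ ?_ hfin
  · rintro g ⟨hg, hM⟩ i j
    have hpp : F (realExt g⁻¹ p) p = F (realExt g p) p := by
      rw [hB.comm, ← baseChange_realExt_left hg]
    have hxp : F (realExt g (1 ⊗ₜ b i)) p = F (1 ⊗ₜ b i) (realExt g⁻¹ p) :=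
      baseChange_realExt_left hg _ _
    have h2 := hb₂ i (realExt g⁻¹ p)
    rw [← hxp, hpp, baseChange_realExt (inv_mem hg)] at h2
    have hM2 : F (realExt g p) p ^ 2 ≤ M ^ 2 := by
      rw [← sq_abs]
      gcongr
    have h3 : F (realExt g (1 ⊗ₜ b i)) p ^ 2 ≤ K₂ i * (2 * M ^ 2 / F p p - F p p) := by
      refine h2.trans (mul_le_mul_of_nonneg_left ?_ (hK₂ i))
      gcongr
    have h1 := hb₁ j (realExt g (1 ⊗ₜ b i))
    rw [baseChange_realExt hg] at h1
    have h4 : ((b.baseChange ℝ).coord j (realExt g (1 ⊗ₜ b i))) ^ 2 ≤ R i j := by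
      refine h1.trans (mul_le_mul_of_nonneg_left ?_ (hK₁ j))
      gcongr
    have h5 : (b.baseChange ℝ).coord j (realExt g (1 ⊗ₜ b i)) = (b.repr (g (b i)) j : ℝ) := by
      simp [realExt]
    rw [h5] at h4
    have h6 : (b.repr (g (b i)) j) ^ 2 ≤ ⌈R i j⌉ := by
      exact_mod_cast h4.trans (Int.le_ceil _)
    simp only [Set.mem_Icc]
    set z := b.repr (g (b i)) j
    constructor <;> nlinarith [Int.le_self_sq z, Int.le_self_sq (-z)]
  · intro g _ h _ hgh
    refine LinearEquiv.toLinearMap_injective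
      (b.ext fun i => b.repr.injective (Finsupp.ext fun j => ?_))
    exact congr_fun (congr_fun hgh i) j

end Isometries

/-! ### Entropy and fixed vectors -/

section Entropy

variable {L : Type*} [AddCommGroup L]

/-- The real and imaginary parts of a complex eigenvector. -/
theorem exists_real_pair_of_hasEigenvalue (g : L ≃ₗ[ℤ] L) {μ : ℂ}
    (h : Module.End.HasEigenvalue ((g : L →ₗ[ℤ] L).baseChange ℂ) μ) :
    ∃ x y : ℝ ⊗[ℤ] L, ¬ (x = 0 ∧ y = 0) ∧ realExt g x = μ.re • x - μ.im • y ∧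
      realExt g y = μ.im • x + μ.re • y := by
  obtain ⟨w, hw⟩ := h.exists_hasEigenvector
  have hgw := hw.apply_eq_smul
  let re : ℂ ⊗[ℤ] L →ₗ[ℤ] ℝ ⊗[ℤ] L := (Complex.reLm.restrictScalars ℤ).rTensor L
  let im : ℂ ⊗[ℤ] L →ₗ[ℤ] ℝ ⊗[ℤ] L := (Complex.imLm.restrictScalars ℤ).rTensor L
  let inc : ℝ ⊗[ℤ] L →ₗ[ℤ] ℂ ⊗[ℤ] L := (Complex.ofRealAm.toLinearMap.restrictScalars ℤ).rTensor L
  have hre : ∀ z l, re (z ⊗ₜ l) = z.re ⊗ₜ l := fun _ _ => rfl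
  have him : ∀ z l, im (z ⊗ₜ l) = z.im ⊗ₜ l := fun _ _ => rfl
  have hinc : ∀ a l, inc (a ⊗ₜ l) = (a : ℂ) ⊗ₜ l := fun _ _ => rfl
  have hdec : ∀ z, inc (re z) + Complex.I • inc (im z) = z := by
    intro z
    induction z with
    | zero => simp
    | add z z' hz hz' =>
      nth_rewrite 3 [← hz]
      nth_rewrite 3 [← hz']
      simp only [map_add, smul_add]
      abel
    | tmul z l =>
      rw [hre, him, hinc, hinc, TensorProduct.smul_tmul', ← TensorProduct.add_tmul, smul_eq_mul,
        mul_comm, Complex.re_add_im]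
  have hgre : ∀ z, realExt g (re z) = re ((g : L →ₗ[ℤ] L).baseChange ℂ z) := by
    intro z
    induction z with
    | zero => simp
    | add z z' hz hz' => simp only [map_add, hz, hz']
    | tmul z l => rfl
  have hgim : ∀ z, realExt g (im z) = im ((g : L →ₗ[ℤ] L).baseChange ℂ z) := by
    intro z
    induction z with
    | zero => simp
    | add z z' hz hz' => simp only [map_add, hz, hz']
    | tmul z l => rfl
  have hμre : ∀ z, re (μ • z) = μ.re • re z - μ.im • im z := by
    intro z
    induction z with
    | zero => simp
    | add z z' hz hz' =>
      simp only [map_add, smul_add, hz, hz']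
      abel
    | tmul z l =>
      simp only [TensorProduct.smul_tmul', hre, him, ← TensorProduct.sub_tmul, smul_eq_mul,
        Complex.mul_re]
  have hμim : ∀ z, im (μ • z) = μ.im • re z + μ.re • im z := by
    intro z
    induction z with
    | zero => simp
    | add z z' hz hz' =>
      simp only [map_add, smul_add, hz, hz']
      abel
    | tmul z l =>
      simp only [TensorProduct.smul_tmul', hre, him, ← TensorProduct.add_tmul, smul_eq_mul,
        Complex.mul_im, add_comm]
  refine ⟨re w, im w, ?_, ?_, ?_⟩
  · rintro ⟨h1, h2⟩
    apply hw.2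
    rw [← hdec w, h1, h2]
    simp
  · rw [hgre, hgw, hμre]
  · rw [hgim, hgw, hμim]

variable {B : LinearMap.BilinForm ℤ L}

/-- An isometry that fixes a nonzero vector of the closed positive cone has no eigenvalue of
modulus different from one. -/
theorem norm_eigenvalue_eq_one (hB : IsLorentzian (B.baseChange ℝ)) {g : L ≃ₗ[ℤ] L}
    (hg : g ∈ isometryGroup B) {v : ℝ ⊗[ℤ] L} (hv : v ≠ 0) (hvv : 0 ≤ B.baseChange ℝ v v)
    (hgv : realExt g v = v) {μ : ℂ}
    (hμ : Module.End.HasEigenvalue ((g : L →ₗ[ℤ] L).baseChange ℂ) μ) : ‖μ‖ = 1 := by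
  obtain ⟨x, y, hxy, hx, hy⟩ := exists_real_pair_of_hasEigenvalue g hμ
  by_contra hne
  set F := B.baseChange ℝ with hF
  obtain ⟨a, b⟩ := μ
  simp only at hx hy
  have hab : a ^ 2 + b ^ 2 ≠ 1 := by
    intro h
    apply hne
    rw [Complex.norm_def, Complex.normSq_mk, ← sq, ← sq, h, Real.sqrt_one]
  -- This sum is the Hermitian norm of `x + iy`, which `g` multiplies by `‖μ‖ ^ 2`.
  have hsum : F x x + F y y = 0 := by
    have h1 := baseChange_realExt hg x x
    have h2 := baseChange_realExt hg y y
    rw [hx] at h1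
    rw [hy] at h2
    simp only [← hF, map_add, map_sub, map_smul, LinearMap.add_apply, LinearMap.sub_apply,
      LinearMap.smul_apply, smul_eq_mul, hB.comm y x] at h1 h2
    have : (a ^ 2 + b ^ 2 - 1) * (F x x + F y y) = 0 := by linear_combination h1 + h2
    exact (mul_eq_zero.1 this).resolve_left (sub_ne_zero.2 hab)
  have hdet : (a - 1) ^ 2 + b ^ 2 ≠ 0 := by
    intro h
    have ha : a = 1 := by nlinarith [sq_nonneg (a - 1), sq_nonneg b]
    have hb : b = 0 := by nlinarith [sq_nonneg (a - 1), sq_nonneg b]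
    simp [ha, hb] at hab
  -- As `v` is fixed, `F x v + i F y v` is multiplied by `μ ≠ 1`, yet invariant.
  have hxv : F x v = 0 ∧ F y v = 0 := by
    have h1 := baseChange_realExt hg x v
    have h2 := baseChange_realExt hg y v
    rw [hx, hgv] at h1
    rw [hy, hgv] at h2
    simp only [← hF, map_add, map_sub, map_smul, LinearMap.add_apply, LinearMap.sub_apply,
      LinearMap.smul_apply, smul_eq_mul] at h1 h2
    constructor
    · refine (mul_eq_zero.1 (?_ : ((a - 1) ^ 2 + b ^ 2) * F x v = 0)).resolve_left hdet
      linear_combination (a - 1) * h1 + b * h2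
    · refine (mul_eq_zero.1 (?_ : ((a - 1) ^ 2 + b ^ 2) * F y v = 0)).resolve_left hdet
      linear_combination (a - 1) * h2 - b * h1
  obtain ⟨hx1, hx2⟩ := hB.nonpos_of_orthogonal hv hvv hxv.1
  obtain ⟨hy1, hy2⟩ := hB.nonpos_of_orthogonal hv hvv hxv.2
  obtain ⟨α, rfl⟩ := hx2 (by linarith)
  obtain ⟨β, rfl⟩ := hy2 (by linarith)
  rw [map_smul, hgv, smul_smul, smul_smul, ← sub_smul] at hx
  rw [map_smul, hgv, smul_smul, smul_smul, ← add_smul] at hy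
  have h1 := smul_left_injective ℝ hv hx
  have h2 := smul_left_injective ℝ hv hy
  have hα : α = 0 := by
    refine (mul_eq_zero.1 (?_ : ((a - 1) ^ 2 + b ^ 2) * α = 0)).resolve_left hdet
    linear_combination -(a - 1) * h1 - b * h2
  have hβ : β = 0 := by
    refine (mul_eq_zero.1 (?_ : ((a - 1) ^ 2 + b ^ 2) * β = 0)).resolve_left hdet
    linear_combination -(a - 1) * h2 + b * h1
  exact hxy (by simp [hα, hβ])

theorem entropy_nonpos_of_fixed (hB : IsLorentzian (B.baseChange ℝ)) {g : L ≃ₗ[ℤ] L}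
    (hg : g ∈ isometryGroup B) {v : ℝ ⊗[ℤ] L} (hv : v ≠ 0) (hvv : 0 ≤ B.baseChange ℝ v v)
    (hgv : realExt g v = v) : entropy (g : L →ₗ[ℤ] L) ≤ 0 := by
  apply Real.log_nonpos
  · apply Real.sSup_nonneg
    rintro r ⟨μ, -, rfl⟩
    exact norm_nonneg μ
  · apply Real.sSup_le _ zero_le_one
    rintro r ⟨μ, hμ, rfl⟩
    exact (norm_eigenvalue_eq_one hB hg hv hvv hgv hμ).le

theorem continuous_bilinForm_self [Module.Finite ℤ L] (F : LinearMap.BilinForm ℝ (ℝ ⊗[ℤ] L)) :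
    Continuous fun y => F y y := by
  have h : Continuous fun y : (ℝ ⊗[ℤ] L) × (ℝ ⊗[ℤ] L) => F y.1 y.2 :=
    IsModuleTopology.continuous_bilinear_of_finite_left F
  exact h.comp (continuous_id.prodMk continuous_id)

theorem form_nonneg_of_mem_closure [Module.Finite ℤ L] {C : Set (ℝ ⊗[ℤ] L)}
    (hC : IsPositiveCone B C) {v : ℝ ⊗[ℤ] L} (hv : v ∈ closure C) : 0 ≤ B.baseChange ℝ v v := by
  obtain ⟨x, -, rfl⟩ := hC
  refine closure_minimal (fun y hy => ?_)
    (isClosed_le continuous_const (continuous_bilinForm_self (B.baseChange ℝ))) hv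
  have hy' : 0 < realForm B y := by
    simpa only [Set.mem_ofPred_eq] using connectedComponentIn_subset _ _ hy
  exact hy'.le

end Entropy

/-! ### Dual eigenvectors and commensurability -/

section Commensurability

variable {L : Type*} [AddCommGroup L] {B : LinearMap.BilinForm ℤ L}

theorem form_eq_zero_of_eigenvector {g : L ≃ₗ[ℤ] L} (hg : g ∈ isometryGroup B)
    {x y : ℝ ⊗[ℤ] L} {c d : ℝ} (hx : realExt g x = c • x) (hy : realExt g y = d • y)
    (hcd : c * d ≠ 1) : B.baseChange ℝ x y = 0 := by
  have h := baseChange_realExt hg x y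
  rw [hx, hy] at h
  simp only [map_smul, LinearMap.smul_apply, smul_eq_mul] at h
  refine (mul_eq_zero.1 (?_ : (c * d - 1) * _ = 0)).resolve_left (sub_ne_zero.2 hcd)
  linear_combination h

variable [Module.Free ℤ L] [Module.Finite ℤ L]

/-- An isometry with an eigenvector for `c` has a dual eigenvector for `c⁻¹`. -/
theorem exists_dual_eigenvector (hB : IsLorentzian (B.baseChange ℝ)) {g : L ≃ₗ[ℤ] L}
    (hg : g ∈ isometryGroup B) {v : ℝ ⊗[ℤ] L} (hv : v ≠ 0) {c : ℝ} (hc : 0 < c) (hc1 : c ≠ 1)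
    (hgv : realExt g v = c • v) :
    ∃ u, realExt g u = c⁻¹ • u ∧ B.baseChange ℝ u u = 0 ∧ B.baseChange ℝ u v = 1 := by
  set F := B.baseChange ℝ
  have hcc : c * c ≠ 1 := fun h => hc1 (by nlinarith)
  have hvv : F v v = 0 := form_eq_zero_of_eigenvector hg hgv hgv hcc
  let f := realExt g - c⁻¹ • LinearMap.id
  -- The range of `f` is orthogonal to `v`, so nondegeneracy rules out surjectivity.
  have hf : ¬ Function.Injective f := by
    intro hinj
    obtain ⟨x, hx⟩ := hB.exists_ne_zero hv
    obtain ⟨y, rfl⟩ := (LinearMap.injective_iff_surjective.1 hinj) x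
    apply hx
    have h : F (realExt g y) v = c⁻¹ * F y v := by
      rw [baseChange_realExt_left hg, realExt_inv_eigenvector g hc.ne' hgv, map_smul, smul_eq_mul]
    rw [hB.comm]
    simp [f, h]
  rw [← LinearMap.ker_eq_bot, Submodule.eq_bot_iff] at hf
  push Not at hf
  obtain ⟨w, hw, hw0⟩ := hf
  have hgw : realExt g w = c⁻¹ • w := sub_eq_zero.1 hw
  have hww : F w w = 0 := form_eq_zero_of_eigenvector hg hgw hgw (by
    rw [← mul_inv]
    exact inv_ne_one.2 hcc)
  have hwv : F w v ≠ 0 := by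
    intro h
    obtain ⟨a, rfl⟩ := (hB.nonpos_of_orthogonal hv hvv.ge h).2 hww
    rw [map_smul, hgv, smul_comm] at hgw
    have := smul_left_injective ℝ hw0 hgw
    apply hcc
    field_simp at this
    linarith
  refine ⟨(F w v)⁻¹ • w, ?_, ?_, ?_⟩
  · rw [map_smul, hgw, smul_comm]
  · simp [hww]
  · simp [hwv]

theorem dual_eigenvector_of_contracting (hB : IsLorentzian (B.baseChange ℝ)) {g₁ g₂ : L ≃ₗ[ℤ] L}
    (hg₁ : g₁ ∈ isometryGroup B) (hg₂ : g₂ ∈ isometryGroup B) {u v : ℝ ⊗[ℤ] L} {c₁ c₂ : ℝ}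
    (hc₁ : 0 < c₁) (hc₁' : c₁ < 1) (hc₂ : 0 < c₂)
    (hv₁ : realExt g₁ v = c₁ • v) (hv₂ : realExt g₂ v = c₂ • v) (hu₁ : realExt g₁ u = c₁⁻¹ • u)
    (hvv : B.baseChange ℝ v v = 0) (huu : B.baseChange ℝ u u = 0)
    (huv : B.baseChange ℝ u v = 1) : realExt g₂ u = c₂⁻¹ • u := by
  set F := B.baseChange ℝ
  have hvu : F v u = 1 := by rw [hB.comm, huv]
  have hu0 : u ≠ 0 := by
    rintro rfl
    simp at huv
  have hp : 0 < F (u + v) (u + v) := by simp [huu, hvv, huv, hvu]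
  have hfin := finite_isometries_of_bounded hB hp (c₂ + |F (realExt g₂ u) v| + |F (realExt g₂ u) u|)
  have hmaps : Set.MapsTo (fun n : ℕ => g₁ ^ (n : ℤ) * g₂ * (g₁ ^ (n : ℤ))⁻¹) Set.univ
      {g | g ∈ isometryGroup B ∧ |F (realExt g (u + v)) (u + v)| ≤
        c₂ + |F (realExt g₂ u) v| + |F (realExt g₂ u) u|} := fun n _ => by
    have hgn : g₁ ^ (n : ℤ) ∈ isometryGroup B := zpow_mem hg₁ _
    refine ⟨mul_mem (mul_mem hgn hg₂) (inv_mem hgn), ?_⟩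
    have hpn : realExt (g₁ ^ (n : ℤ))⁻¹ (u + v) = c₁ ^ n • u + (c₁ ^ n)⁻¹ • v := by
      rw [map_add, realExt_inv_eigenvector _ _ (realExt_zpow_apply g₁ hc₁.ne' hv₁ n),
        realExt_inv_eigenvector _ _ (realExt_zpow_apply g₁ (inv_ne_zero hc₁.ne') hu₁ n)]
      · simp
      · positivity
      · positivity
    beta_reduce
    rw [mul_assoc, realExt_mul_apply, baseChange_realExt_left hgn, realExt_mul_apply, hpn]
    have hcn : c₁ ^ n ≠ 0 := by positivity
    -- The unbounded coefficient `(c₁ ^ n)⁻¹ ^ 2` only meets `F v v = 0`.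
    have hval : F (realExt g₂ (c₁ ^ n • u + (c₁ ^ n)⁻¹ • v)) (c₁ ^ n • u + (c₁ ^ n)⁻¹ • v) =
        c₂ + F (realExt g₂ u) v + (c₁ ^ n) ^ 2 * F (realExt g₂ u) u := by
      simp [hv₂, hvu, hvv]
      field_simp
      ring
    rw [hval]
    have h1 : (c₁ ^ n) ^ 2 ≤ 1 := pow_le_one₀ (by positivity) (pow_le_one₀ hc₁.le hc₁'.le)
    calc _ ≤ |c₂| + |F (realExt g₂ u) v| + |(c₁ ^ n) ^ 2 * F (realExt g₂ u) u| := abs_add_three _ _ _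
      _ ≤ _ := by
        rw [abs_of_pos hc₂, abs_mul, abs_of_nonneg (sq_nonneg (c₁ ^ n))]
        gcongr
        exact mul_le_of_le_one_left (abs_nonneg _) h1
  obtain ⟨n, -, m, -, hnm, heq⟩ := Set.infinite_univ.exists_ne_map_eq_of_mapsTo hmaps hfin
  set k : ℤ := m - n with hk
  have hk0 : k ≠ 0 := by omega
  have hcomm : g₁ ^ k * g₂ = g₂ * g₁ ^ k := by
    rw [hk, sub_eq_neg_add, zpow_add, zpow_neg]
    have h := congr_arg (fun x => (g₁ ^ (n : ℤ))⁻¹ * x * g₁ ^ (m : ℤ)) heq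
    have hc : g₁ ^ (m : ℤ) * (g₁ ^ (n : ℤ))⁻¹ = (g₁ ^ (n : ℤ))⁻¹ * g₁ ^ (m : ℤ) := by
      rw [← zpow_neg, ← zpow_add, ← zpow_add, add_comm]
    rw [← hc]
    calc _ = (g₁ ^ (n : ℤ))⁻¹ * (g₁ ^ (m : ℤ) * g₂ * (g₁ ^ (m : ℤ))⁻¹) * g₁ ^ (m : ℤ) := by
          rw [hc]; group
      _ = (g₁ ^ (n : ℤ))⁻¹ * (g₁ ^ (n : ℤ) * g₂ * (g₁ ^ (n : ℤ))⁻¹) * g₁ ^ (m : ℤ) := by rw [heq]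
      _ = _ := by rw [hc]; group
  have hku := realExt_zpow_apply g₁ (inv_ne_zero hc₁.ne') hu₁ k
  have hkgu : realExt (g₁ ^ k) (realExt g₂ u) = (c₁⁻¹) ^ k • realExt g₂ u := by
    rw [← realExt_mul_apply, hcomm, realExt_mul_apply, hku, map_smul]
  have hck : (c₁⁻¹) ^ k * (c₁⁻¹) ^ k ≠ 1 := by
    intro h
    rw [← zpow_add₀ (inv_ne_zero hc₁.ne'), zpow_eq_one_iff_right₀ (by positivity)
      (inv_ne_one.2 hc₁'.ne)] at h
    omega
  -- `u` and `g₂ u` share an eigenvalue of `g₁ ^ k` whose square is not 1. Orthogonal isotropic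
  -- vectors are proportional, and pairing with `v` fixes the factor.
  have hgu : F (realExt g₂ u) u = 0 := form_eq_zero_of_eigenvector (zpow_mem hg₁ k) hkgu hku hck
  obtain ⟨a, ha⟩ := (hB.nonpos_of_orthogonal hu0 huu.ge hgu).2
    (by rw [baseChange_realExt hg₂]; exact huu)
  have h1 := baseChange_realExt hg₂ u v
  rw [ha, hv₂] at h1
  rw [ha]
  congr 1
  apply eq_inv_of_mul_eq_one_left
  change F (a • u) (c₂ • v) = F u v at h1
  simpa [huv, mul_comm] using h1

theorem exists_zpow_eq_of_contracting (hB : IsLorentzian (B.baseChange ℝ)) {g₁ g₂ : L ≃ₗ[ℤ] L}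
    (hg₁ : g₁ ∈ isometryGroup B) (hg₂ : g₂ ∈ isometryGroup B) {v : ℝ ⊗[ℤ] L} (hv : v ≠ 0)
    {c₁ c₂ : ℝ} (hc₁ : 0 < c₁) (hc₁' : c₁ < 1) (hc₂ : 0 < c₂) (hc₂' : c₂ ≠ 1)
    (hv₁ : realExt g₁ v = c₁ • v) (hv₂ : realExt g₂ v = c₂ • v) :
    ∃ t₁ t₂ : ℤ, t₁ ≠ 0 ∧ t₂ ≠ 0 ∧ g₁ ^ t₁ = g₂ ^ t₂ := by
  obtain ⟨u, hu₁, huu, huv⟩ := exists_dual_eigenvector hB hg₁ hv hc₁ hc₁'.ne hv₁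
  set F := B.baseChange ℝ
  have hvv : F v v = 0 :=
    form_eq_zero_of_eigenvector hg₁ hv₁ hv₁
      (mul_lt_one_of_nonneg_of_lt_one_left hc₁.le hc₁' hc₁'.le).ne
  have hu₂ := dual_eigenvector_of_contracting hB hg₁ hg₂ hc₁ hc₁' hc₂ hv₁ hv₂ hu₁ hvv huu huv
  have hvu : F v u = 1 := by rw [hB.comm, huv]
  have hp : 0 < F (u + v) (u + v) := by simp [huu, hvv, huv, hvu]
  -- `e b` is chosen so that `c₁ ^ e b * c₂ ^ b` lies in `[1, c₁⁻¹)`.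
  choose e he he' using fun b : ℕ =>
    exists_mem_Ico_zpow (x := c₂ ^ b) (y := c₁⁻¹) (by positivity) (one_lt_inv₀ hc₁ |>.2 hc₁')
  have hfin := finite_isometries_of_bounded hB hp (1 + c₁⁻¹)
  have hmaps : Set.MapsTo (fun b : ℕ => g₁ ^ e b * g₂ ^ (b : ℤ)) Set.univ
      {g | g ∈ isometryGroup B ∧ |F (realExt g (u + v)) (u + v)| ≤ 1 + c₁⁻¹} := fun b _ => by
    refine ⟨mul_mem (zpow_mem hg₁ _) (zpow_mem hg₂ _), ?_⟩
    set χ := c₁ ^ e b * c₂ ^ b with hχ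
    have hce : 0 < c₁ ^ e b := by positivity
    have hχ1 : 1 ≤ χ := by
      have := he b
      rw [inv_zpow, inv_le_iff_one_le_mul₀ hce] at this
      rwa [hχ, mul_comm]
    have hχ2 : χ ≤ c₁⁻¹ := by
      have h := (he' b).le
      rw [zpow_add_one₀ (inv_ne_zero hc₁.ne'), inv_zpow, ← div_eq_inv_mul, le_div_iff₀ hce] at h
      rwa [hχ, mul_comm]
    have hval : F (realExt (g₁ ^ e b * g₂ ^ (b : ℤ)) (u + v)) (u + v) = χ⁻¹ + χ := by
      rw [realExt_mul_apply, map_add (realExt _) u v,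
        realExt_zpow_apply g₂ (inv_ne_zero hc₂.ne') hu₂, realExt_zpow_apply g₂ hc₂.ne' hv₂,
        map_add (realExt _), map_smul, map_smul,
        realExt_zpow_apply g₁ (inv_ne_zero hc₁.ne') hu₁, realExt_zpow_apply g₁ hc₁.ne' hv₁]
      simp [huu, hvv, huv, hvu, hχ]
      ring
    rw [hval, abs_of_pos (by positivity)]
    exact add_le_add (inv_le_one_of_one_le₀ hχ1) hχ2
  obtain ⟨a, -, b, -, hab, heq⟩ := Set.infinite_univ.exists_ne_map_eq_of_mapsTo hmaps hfin
  have hrel : g₁ ^ (e a - e b) = g₂ ^ ((b : ℤ) - a) := by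
    rw [sub_eq_neg_add, zpow_add, zpow_neg, zpow_sub, inv_mul_eq_iff_eq_mul, ← mul_assoc, ← heq]
    group
  -- If the exponent of `g₁` vanished, a nontrivial power of `c₂ ≠ 1` would equal 1.
  refine ⟨e a - e b, b - a, fun h0 => ?_, by omega, hrel⟩
  rw [h0, zpow_zero] at hrel
  have h := realExt_zpow_apply g₂ hc₂.ne' hv₂ ((b : ℤ) - a)
  rw [← hrel, realExt_one, LinearMap.id_apply] at h
  have h1 : c₂ ^ ((b : ℤ) - a) = 1 := by
    apply smul_left_injective ℝ hv
    simpa using h.symm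
  rw [zpow_eq_one_iff_right₀ hc₂.le hc₂'] at h1
  omega

end Commensurability

end HyperbolicLattice

theorem proposition3p10 {L : Type*} [AddCommGroup L] [Module.Free ℤ L] [Module.Finite ℤ L]
    (B : LinearMap.BilinForm ℤ L)
    (hB : HyperbolicLattice.IsHyperbolic B)
    (C : Set (ℝ ⊗[ℤ] L)) (hC : HyperbolicLattice.IsPositiveCone B C)
    (g₁ g₂ : L ≃ₗ[ℤ] L)
    (hg₁ : g₁ ∈ HyperbolicLattice.coneIsometryGroup B C)
    (hg₂ : g₂ ∈ HyperbolicLattice.coneIsometryGroup B C)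
    (he₁ : 0 < HyperbolicLattice.entropy (g₁ : L →ₗ[ℤ] L))
    (he₂ : 0 < HyperbolicLattice.entropy (g₂ : L →ₗ[ℤ] L))
    (v : ℝ ⊗[ℤ] L) (hv : v ≠ 0) (hvC : v ∈ closure C)
    (c₁ c₂ : ℝ) (hc₁ : 0 < c₁) (hc₂ : 0 < c₂)
    (hgv₁ : HyperbolicLattice.realExt g₁ v = c₁ • v)
    (hgv₂ : HyperbolicLattice.realExt g₂ v = c₂ • v) :
    ∃ t₁ t₂ : ℤ, t₁ ≠ 0 ∧ t₂ ≠ 0 ∧ g₁ ^ t₁ = g₂ ^ t₂ := by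
  have hF := hB.isLorentzian
  have hvv := HyperbolicLattice.form_nonneg_of_mem_closure hC hvC
  have hc₁' : c₁ ≠ 1 := by
    rintro rfl
    rw [one_smul] at hgv₁
    exact he₁.not_ge (HyperbolicLattice.entropy_nonpos_of_fixed hF hg₁.1 hv hvv hgv₁)
  have hc₂' : c₂ ≠ 1 := by
    rintro rfl
    rw [one_smul] at hgv₂
    exact he₂.not_ge (HyperbolicLattice.entropy_nonpos_of_fixed hF hg₂.1 hv hvv hgv₂)
  rcases hc₁'.lt_or_gt with h | h
  · exact HyperbolicLattice.exists_zpow_eq_of_contracting hF hg₁.1 hg₂.1 hv hc₁ h hc₂ hc₂' hgv₁ hgv₂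
  -- For `c₁ > 1`, the inverse of `g₁` contracts `v`.
  · obtain ⟨t₁, t₂, h₁, h₂, heq⟩ := HyperbolicLattice.exists_zpow_eq_of_contracting hF
      (inv_mem hg₁.1) hg₂.1 hv (inv_pos.2 hc₁) (inv_lt_one_of_one_lt₀ h) hc₂ hc₂'
      (HyperbolicLattice.realExt_inv_eigenvector g₁ hc₁.ne' hgv₁) hgv₂
    exact ⟨-t₁, t₂, neg_ne_zero.2 h₁, h₂, by rw [← heq, inv_zpow']⟩
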